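/- **Setting.** Let $F$ (facilities) and $C$ (clients) be finite, let $d$ be a metric on $F\cup C$ (distinct points may be collocated, i.e. at distance $0$). A knapsack median instance $(F,C,d,w,B)$ has weights $w\in\mathbb R_{\ge 0}^F$ and a budget $B\ge 0$; its side constraints are $\sum_{i} w_iy_i\le B$ and coverage of all $|C|$ clients. A $k$-median with outliers instance $(F,C,d,k,m)$ has the side constraints $\sum_i y_i\le k$ and coverage of $m$ clients. Write $y(A)=\sum_{i\in A}y_i$. Fix $\tau>1$ and $\alpha_0\in[1,\tau)$, put $L(-2)=-1$, $L(-1)=0$, $L(\ell)=\alpha_0\tau^\ell$ for $\ell\ge 0$, and let $d'(p,q)$ be the least $L(\ell)$, $\ell\ge -1$, with $d(p,q)\le L(\ell)$. **The linear program.** The data of $LP_{iter}$ are a current facility set (again written $F$ below), sets $C_{part},C_{full},C^*\subseteq C$, and for every $j\in C$ a ball $F_j\subseteq F$ and a radius level $\ell_j\in\mathbb Z$; put $B_j=\{i\in F_j: d'(j,i)\le L(\ell_j-1)\}$. $LP_{iter}$ minimizes $$\sum_{j\in C_{part}}\sum_{i\in F_j}d'(i,j)y_i+\sum_{j\in C_{full}\cup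 C^*}\Big(\sum_{i\in B_j}d'(i,j)y_i+(1-y(B_j))L(\ell_j)\Big)$$ over $y\in[0,1]^F$ subject to $y(F_j)\le 1$ for $j\in C_{part}$, $y(B_j)\le 1$ for $j\in C_{full}$, $y(F_j)=1$ for $j\in C^*$, the knapsack constraint ($\sum_i w_iy_i\le B$, resp. $y(F)\le k$), and the coverage constraint $\sum_{j\in C_{part}}y(F_j)\ge M-|C_{full}\cup C^*|$, where $M=|C|$, resp. $M=m$. **Basic Invariants.** $C_{part},C_{full},C^*$ partition $C$; $d'(j,i)\le L(\ell_j)$ for all $i\in F_j$; $\ell_j\ge -1$ for all $j$; and $|\ell_j-\ell_{j'}|=1$ for all distinct $j,j'\in C^*$ with $F_j\cap F_{j'}\ne\emptyset$. **The algorithm PseudoApproximation.** *ReRoute*$(j)$, for $j\in C_{full}$: if $\ell_j\le\ell_{j'}-1$ for all $j'\in C^*$ with $F_j\cap F_{j'}\neq\emptyset$, move $j$ to $C^*$, and move every $j'\in C^*$ with $F_j\cap F_{j'}\ne\emptyset$ and $\ell_{j'}\ge\ell_j+2$ from $C^*$ to $C_{full}$. An iteration of PseudoApproximation computes an optimal extreme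 point $\bar y$ of $LP_{iter}$ and does one of the following, if applicable: (a) delete from $F$, and from all the balls, a facility $i$ with $\bar y_i=0$; (b) move some $j\in C_{part}$ with $\bar y(F_j)=1$ to $C_{full}$ and run ReRoute$(j)$; (c) for some $j\in C_{full}$ with $\bar y(B_j)=1$, replace $F_j$ by $B_j$, decrement $\ell_j$ by $1$, and run ReRoute$(j)$. (Any order of these tests and any choice of $i$, $j$ is allowed.) If none of (a)-(c) applies and there is a candidate configuration $(j,j')$, i.e. $j,j'\in C^*$ with $F_j\cap F_{j'}\neq\emptyset$, $\ell_{j'}\le\ell_j-1$, every $i\in F_j$ in exactly two balls $F_{j''}$ with $j''\in C^*$, and each of $F_j$, $F_{j'}$ containing exactly two facilities with $\bar y_i<1$, then it moves $j$ from $C^*$ to $C_{full}$. If there is none, it outputs $\bar y$ and terminates. **Extra Invariants.** Let $\rho,\delta\in(0,1/2)$, $U\ge 0$, a set $S_0$ of facilities of the instance, and $R\in\mathbb R_{\ge 0}^C$ be given. With $B_C(p,r)=\{j\in C: d(p,j)\le r\}$, the Extra Invariants for knapsack median are: 1. for all $i\in S_0$ there is $j(i)\in C^*$ with $F_{j(i)}=\{i'\in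 F: i'\text{ collocated with }i\}$ and $\ell_{j(i)}=-1$; 2. $\sum_{j: i\in F_j}d(i,j)\le 2\rho U$ for all $i\in F$ that are not collocated with any $i'\in S_0$; 3. $L(\ell_j)\le\tau R_j$ for all $j\in C$; 4. $|B_C(j,\delta r)|\,r\le\rho U$ for all $j\in C$ and $0\le r\le R_j$. For $k$-median with outliers they are 1, 3, and 2, 4 with the following replacements: 2'. $\sum_{j: i\in F_j}d(i,j)\le\rho(1+\delta)U$ for all $i\in F$ that are not collocated with any $i'\in S_0$; 4'. for all $t>0$ and $p\in F\cup C$, $$\Big|\Big\{j\in B_C\Big(p,\tfrac{\delta t}{4+3\delta}\Big): R_j\ge t\Big\}\Big|\le\frac{\rho(1+3\delta/4)}{1-\delta/4}\cdot\frac Ut .$$ **Proposition.** (i) If, for a knapsack median instance, $LP_{iter}$ satisfies all Basic Invariants and all Extra Invariants for knapsack median, then after any finite number of iterations of PseudoApproximation (in particular upon termination) the resulting $LP_{iter}$ satisfies all Extra Invariants for knapsack median, with the same $\rho,\delta,U,S_0,R$. (ii) The same holds for $k$-median with outliers and its Extra Invariants. -/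

import Mathlib

open scoped Matrix

noncomputable section

/-! ## Generalized k-median instances -/

/-- An instance of generalized `k`-median: facilities `F`, clients `C`, a metric on the disjoint
union of `F` and `C` (distinct points may be collocated, i.e. at distance zero), `r₁` knapsack
constraints `W y ≤ b` and `r₂` coverage constraints with client weights `a` and demands `c`. -/
structure GKMInstance (F C : Type*) (r₁ r₂ : ℕ) where
  metric : PseudoMetricSpace (F ⊕ C)
  W : Matrix (Fin r₁) F ℝ
  b : Fin r₁ → ℝ
  a : C → Fin r₂ → ℝ
  c : Fin r₂ → ℝ
  W_nonneg : ∀ q i, 0 ≤ W q i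
  b_nonneg : ∀ q, 0 ≤ b q
  a_nonneg : ∀ j q, 0 ≤ a j q
  c_nonneg : ∀ q, 0 ≤ c q

/-- The distance between two points of `F ∪ C`. -/
def GKMInstance.d {F C : Type*} {r₁ r₂ : ℕ} (I : GKMInstance F C r₁ r₂) (p q : F ⊕ C) : ℝ :=
  I.metric.dist p q

/-- An instance `(F, C, d, w, B)` of knapsack median. -/
structure KnapsackMedian (F C : Type*) where
  metric : PseudoMetricSpace (F ⊕ C)
  w : F → ℝ
  B : ℝ
  w_nonneg : ∀ i, 0 ≤ w i
  B_nonneg : 0 ≤ B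

/-- Knapsack median as generalized `k`-median: one knapsack constraint, and one coverage
constraint that asks for all the clients to be served. -/
def KnapsackMedian.toGKM {F C : Type*} [Fintype C] (I : KnapsackMedian F C) :
    GKMInstance F C 1 1 where
  metric := I.metric
  W := fun _ i => I.w i
  b := fun _ => I.B
  a := fun _ _ => 1
  c := fun _ => (Fintype.card C : ℝ)
  W_nonneg := fun _ i => I.w_nonneg i
  b_nonneg := fun _ => I.B_nonneg
  a_nonneg := fun _ _ => zero_le_one
  c_nonneg := fun _ => Nat.cast_nonneg _

/-- An instance `(F, C, d, k, m)` of `k`-median with outliers. -/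
structure OutlierMedian (F C : Type*) where
  metric : PseudoMetricSpace (F ⊕ C)
  k : ℕ
  m : ℕ

/-- `k`-median with outliers as generalized `k`-median: open at most `k` facilities, serve at
least `m` clients. -/
def OutlierMedian.toGKM {F C : Type*} (I : OutlierMedian F C) : GKMInstance F C 1 1 where
  metric := I.metric
  W := fun _ _ => 1
  b := fun _ => (I.k : ℝ)
  a := fun _ _ => 1
  c := fun _ => (I.m : ℝ)
  W_nonneg := fun _ _ => zero_le_one
  b_nonneg := fun _ => Nat.cast_nonneg _
  a_nonneg := fun _ _ => zero_le_one
  c_nonneg := fun _ => Nat.cast_nonneg _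

/-! ## Radius levels and discretized distances -/

/-- The ratio `τ > 1` of the geometric discretization and its offset `α ∈ [1, τ)`. -/
structure RadiusScale where
  τ : ℝ
  α : ℝ
  one_lt_τ : 1 < τ
  one_le_α : 1 ≤ α
  α_lt_τ : α < τ

/-- The radii: `L(-2) = -1`, `L(-1) = 0`, and `L(ℓ) = α τ ^ ℓ` for `ℓ ≥ 0`. (Levels below `-2`
do not occur.) -/
def RadiusScale.L (σ : RadiusScale) (l : ℤ) : ℝ :=
  if 0 ≤ l then σ.α * σ.τ ^ l else if l = -1 then 0 else -1

/-- The discretized distance: the smallest radius `L(ℓ)`, `ℓ ≥ -1`, that is at least `d(p, q)`. -/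
def GKMInstance.d' {F C : Type*} {r₁ r₂ : ℕ} (I : GKMInstance F C r₁ r₂) (σ : RadiusScale)
    (p q : F ⊕ C) : ℝ :=
  sInf {x : ℝ | ∃ l : ℤ, -1 ≤ l ∧ x = σ.L l ∧ I.d p q ≤ σ.L l}

/-! ## The linear program that is maintained by iterative rounding -/

/-- The data of `LP_iter`: the current set of facilities, the three sets of clients
`C_part`, `C_full`, `C^*`, the `F`-ball `F_j` and the radius level `ℓ_j` of each client. -/
structure LPIter (F C : Type*) where
  facilities : Finset F
  part : Finset C
  full : Finset C
  star : Finset C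
  ball : C → Finset F
  level : C → ℤ
  ball_subset : ∀ j, ball j ⊆ facilities

namespace LPIter

/-- The inner ball `B_j = {i ∈ F_j | d'(j, i) ≤ L(ℓ_j - 1)}`. -/
def inner {F C : Type*} {r₁ r₂ : ℕ} (s : LPIter F C) (I : GKMInstance F C r₁ r₂)
    (σ : RadiusScale) (j : C) : Finset F :=
  {i ∈ s.ball j | I.d' σ (Sum.inr j) (Sum.inl i) ≤ σ.L (s.level j - 1)}

/-- The objective function of `LP_iter`. -/
def objective {F C : Type*} {r₁ r₂ : ℕ} [DecidableEq C] (s : LPIter F C)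
    (I : GKMInstance F C r₁ r₂) (σ : RadiusScale) (y : F → ℝ) : ℝ :=
  (∑ j ∈ s.part, ∑ i ∈ s.ball j, I.d' σ (Sum.inr j) (Sum.inl i) * y i)
    + ∑ j ∈ s.full ∪ s.star,
        ((∑ i ∈ s.inner I σ j, I.d' σ (Sum.inr j) (Sum.inl i) * y i)
          + (1 - ∑ i ∈ s.inner I σ j, y i) * σ.L (s.level j))

/-- The constraints of `LP_iter`. The variables are indexed by the current facilities: a vector
`y` is extended by zero to the facilities that have been deleted. -/
structure Feasible {F C : Type*} {r₁ r₂ : ℕ} [Fintype F] [DecidableEq C] (s : LPIter F C)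
    (I : GKMInstance F C r₁ r₂) (σ : RadiusScale) (y : F → ℝ) : Prop where
  nonneg : ∀ i, 0 ≤ y i
  le_one : ∀ i, y i ≤ 1
  deleted : ∀ i, i ∉ s.facilities → y i = 0
  part_le : ∀ j ∈ s.part, ∑ i ∈ s.ball j, y i ≤ 1
  full_le : ∀ j ∈ s.full, ∑ i ∈ s.inner I σ j, y i ≤ 1
  star_eq : ∀ j ∈ s.star, ∑ i ∈ s.ball j, y i = 1
  knapsack : ∀ q, (I.W *ᵥ y) q ≤ I.b q
  coverage : ∀ q, I.c q - ∑ j ∈ s.full ∪ s.star, I.a j q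
    ≤ ∑ j ∈ s.part, I.a j q * ∑ i ∈ s.ball j, y i

/-- `y` is an optimal extreme point of `LP_iter`. -/
def IsOptimalExtremePoint {F C : Type*} {r₁ r₂ : ℕ} [Fintype F] [DecidableEq C]
    (s : LPIter F C) (I : GKMInstance F C r₁ r₂) (σ : RadiusScale) (y : F → ℝ) : Prop :=
  y ∈ Set.extremePoints ℝ {z : F → ℝ | s.Feasible I σ z} ∧
    IsMinOn (s.objective I σ) {z : F → ℝ | s.Feasible I σ z} y

/-- The Basic Invariants. (The inner balls have their required form by definition.) -/
structure BasicInvariants {F C : Type*} {r₁ r₂ : ℕ} [Fintype C] [DecidableEq F] [DecidableEq C]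
    (s : LPIter F C) (I : GKMInstance F C r₁ r₂) (σ : RadiusScale) : Prop where
  cover : s.part ∪ s.full ∪ s.star = Finset.univ
  disjoint_part_full : Disjoint s.part s.full
  disjoint_part_star : Disjoint s.part s.star
  disjoint_full_star : Disjoint s.full s.star
  radius : ∀ j, ∀ i ∈ s.ball j, I.d' σ (Sum.inr j) (Sum.inl i) ≤ σ.L (s.level j)
  level_ge : ∀ j, -1 ≤ s.level j
  /-- Two clients of `C^*` whose `F`-balls meet differ by exactly one radius level. -/
  distinct_neighbors : ∀ j ∈ s.star, ∀ j' ∈ s.star, j ≠ j' →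
    (s.ball j ∩ s.ball j').Nonempty → |s.level j - s.level j'| = 1

/-! ## The modifications of the linear program -/

/-- Delete the facility `i`, from the set of facilities and hence from all balls. -/
def deleteFacility {F C : Type*} [DecidableEq F] (s : LPIter F C) (i : F) : LPIter F C :=
  { s with
    facilities := s.facilities.erase i
    ball := fun j => (s.ball j).erase i
    ball_subset := fun j => Finset.erase_subset_erase i (s.ball_subset j) }

/-- Move `j` from `C_part` to `C_full`. -/
def movePartToFull {F C : Type*} [DecidableEq C] (s : LPIter F C) (j : C) : LPIter F C :=
  { s with part := s.part.erase j, full := insert j s.full }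

/-- Move `j` from `C^*` to `C_full`. -/
def moveStarToFull {F C : Type*} [DecidableEq C] (s : LPIter F C) (j : C) : LPIter F C :=
  { s with star := s.star.erase j, full := insert j s.full }

/-- Replace `F_j` by `B_j` and decrement `ℓ_j`. (This updates `B_j` too.) -/
def shrink {F C : Type*} {r₁ r₂ : ℕ} [DecidableEq C] (s : LPIter F C)
    (I : GKMInstance F C r₁ r₂) (σ : RadiusScale) (j : C) : LPIter F C :=
  { s with
    ball := fun j' => if j' = j then s.inner I σ j else s.ball j'
    level := fun j' => if j' = j then s.level j - 1 else s.level j'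
    ball_subset := by
      intro j'
      by_cases h : j' = j
      · simp only [h, if_true]
        exact (Finset.filter_subset _ _).trans (s.ball_subset j)
      · simp only [h, if_false]
        exact s.ball_subset j' }

/-- The clients of `C^*` whose `F`-ball meets that of `j`. -/
def neighbors {F C : Type*} [DecidableEq F] (s : LPIter F C) (j : C) : Finset C :=
  {j' ∈ s.star | (s.ball j ∩ s.ball j').Nonempty}

/-- `ReRoute(j)`, for a client `j ∈ C_full`: if `ℓ_j ≤ ℓ_{j'} - 1` for all `j' ∈ C^*` with
`F_j ∩ F_{j'} ≠ ∅`, then move `j` to `C^*`, and move all `j' ∈ C^*` with `F_j ∩ F_{j'} ≠ ∅` and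
`ℓ_{j'} ≥ ℓ_j + 2` from `C^*` to `C_full`. -/
def reRoute {F C : Type*} [DecidableEq F] [DecidableEq C] (s : LPIter F C) (j : C) :
    LPIter F C :=
  if ∀ j' ∈ s.neighbors j, s.level j ≤ s.level j' - 1 then
    { s with
      star := insert j (s.star \ {j' ∈ s.neighbors j | s.level j + 2 ≤ s.level j'})
      full := s.full.erase j ∪ {j' ∈ s.neighbors j | s.level j + 2 ≤ s.level j'} }
  else s

/-- The facilities of `F_j` that are fractional, i.e. with `y_i < 1`. -/
def fractional {F C : Type*} (s : LPIter F C) (y : F → ℝ) (j : C) : Finset F :=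
  {i ∈ s.ball j | y i < 1}

/-- The pair `(j, j')` is a candidate configuration with respect to `y`. -/
structure IsCandidateConfiguration {F C : Type*} [DecidableEq F]
    (s : LPIter F C) (y : F → ℝ) (j j' : C) : Prop where
  left_mem : j ∈ s.star
  right_mem : j' ∈ s.star
  meet : (s.ball j ∩ s.ball j').Nonempty
  level_le : s.level j' ≤ s.level j - 1
  two_balls : ∀ i ∈ s.ball j, Finset.card {j'' ∈ s.star | i ∈ s.ball j''} = 2
  left_fractional : (s.fractional y j).card = 2
  right_fractional : (s.fractional y j').card = 2

/-! ## The algorithms -/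

/-- One iteration of `IterativeRound` for the optimal extreme point `y` of `LP_iter`: delete a
facility with `y_i = 0`, or move a client `j ∈ C_part` with `y(F_j) = 1` to `C_full` and re-route
it, or shrink the ball of a client `j ∈ C_full` with `y(B_j) = 1` and re-route it. All orders in
which these three tests may be made, and all choices of `i` and `j`, are allowed. -/
inductive IterativeRoundStep {F C : Type*} {r₁ r₂ : ℕ} [DecidableEq F] [DecidableEq C]
    (I : GKMInstance F C r₁ r₂) (σ : RadiusScale) (s : LPIter F C) (y : F → ℝ) :
    LPIter F C → Prop
  | delete (i : F) (hi : i ∈ s.facilities) (hy : y i = 0) :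
      IterativeRoundStep I σ s y (s.deleteFacility i)
  | connect (j : C) (hj : j ∈ s.part) (hy : ∑ i ∈ s.ball j, y i = 1) :
      IterativeRoundStep I σ s y ((s.movePartToFull j).reRoute j)
  | shrink (j : C) (hj : j ∈ s.full) (hy : ∑ i ∈ s.inner I σ j, y i = 1) :
      IterativeRoundStep I σ s y ((s.shrink I σ j).reRoute j)

/-- One iteration of `PseudoApproximation`. It solves `LP_iter` to get an optimal extreme point
`y`, and carries out an iteration of `IterativeRound` with it. When `IterativeRound` has
terminated with output `y`, it looks for a candidate configuration `(j, j')` and moves `j` from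
`C^*` to `C_full`; if there is none, the algorithm outputs `y` and terminates. -/
inductive PseudoApproximationStep {F C : Type*} {r₁ r₂ : ℕ} [Fintype F] [DecidableEq F]
    [DecidableEq C] (I : GKMInstance F C r₁ r₂) (σ : RadiusScale) (s : LPIter F C) :
    LPIter F C → Prop
  | round (y : F → ℝ) (hy : s.IsOptimalExtremePoint I σ y) (s' : LPIter F C)
      (hs : IterativeRoundStep I σ s y s') : PseudoApproximationStep I σ s s'
  | configReRoute (y : F → ℝ) (hy : s.IsOptimalExtremePoint I σ y)
      (hs : ∀ s' : LPIter F C, ¬ IterativeRoundStep I σ s y s') (j j' : C)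
      (hj : s.IsCandidateConfiguration y j j') :
      PseudoApproximationStep I σ s (s.moveStarToFull j)

/-- `LP_iter` has been turned from `s` into `s'` after finitely many (maybe zero) iterations of
`PseudoApproximation`. -/
def PseudoApproximationRun {F C : Type*} {r₁ r₂ : ℕ} [Fintype F] [DecidableEq F] [DecidableEq C]
    (I : GKMInstance F C r₁ r₂) (σ : RadiusScale) (s s' : LPIter F C) : Prop :=
  Relation.ReflTransGen (PseudoApproximationStep I σ) s s'

end LPIter

/-! ## The Extra Invariants -/

/-- The data with respect to which the Extra Invariants are stated. -/
structure ExtraData (F C : Type*) where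
  ρ : ℝ
  δ : ℝ
  U : ℝ
  S₀ : Finset F
  R : C → ℝ
  ρ_mem : ρ ∈ Set.Ioo (0 : ℝ) (1 / 2)
  δ_mem : δ ∈ Set.Ioo (0 : ℝ) (1 / 2)
  U_nonneg : 0 ≤ U
  R_nonneg : ∀ j, 0 ≤ R j

/-- The ball `B_C(p, r)` of clients. -/
def GKMInstance.clientBall {F C : Type*} {r₁ r₂ : ℕ} [Fintype C] (I : GKMInstance F C r₁ r₂)
    (p : F ⊕ C) (r : ℝ) : Finset C :=
  {j : C | I.d p (Sum.inr j) ≤ r}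

/-- Two facilities are collocated if their distance is zero. -/
def GKMInstance.Collocated {F C : Type*} {r₁ r₂ : ℕ} (I : GKMInstance F C r₁ r₂) (i i' : F) :
    Prop :=
  I.d (Sum.inl i) (Sum.inl i') = 0

/-- The Extra Invariants for knapsack median. -/
structure KnapsackExtraInvariants {F C : Type*} [Fintype C] [DecidableEq F]
    (I : KnapsackMedian F C) (σ : RadiusScale) (E : ExtraData F C) (s : LPIter F C) : Prop where
  guessed : ∀ i ∈ E.S₀, ∃ j ∈ s.star,
    (∀ i' : F, i' ∈ s.ball j ↔ i' ∈ s.facilities ∧ I.toGKM.Collocated i' i) ∧ s.level j = -1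
  sparse_facility : ∀ i ∈ s.facilities, (∀ i' ∈ E.S₀, ¬ I.toGKM.Collocated i i') →
    ∑ j : C with i ∈ s.ball j, I.toGKM.d (Sum.inl i) (Sum.inr j) ≤ 2 * E.ρ * E.U
  radius_le : ∀ j : C, σ.L (s.level j) ≤ σ.τ * E.R j
  sparse_radius : ∀ (j : C) (r : ℝ), 0 ≤ r → r ≤ E.R j →
    ((I.toGKM.clientBall (Sum.inr j) (E.δ * r)).card : ℝ) * r ≤ E.ρ * E.U

/-- The Extra Invariants for `k`-median with outliers. -/
structure OutlierExtraInvariants {F C : Type*} [Fintype C] [DecidableEq F]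
    (I : OutlierMedian F C) (σ : RadiusScale) (E : ExtraData F C) (s : LPIter F C) : Prop where
  guessed : ∀ i ∈ E.S₀, ∃ j ∈ s.star,
    (∀ i' : F, i' ∈ s.ball j ↔ i' ∈ s.facilities ∧ I.toGKM.Collocated i' i) ∧ s.level j = -1
  sparse_facility : ∀ i ∈ s.facilities, (∀ i' ∈ E.S₀, ¬ I.toGKM.Collocated i i') →
    ∑ j : C with i ∈ s.ball j, I.toGKM.d (Sum.inl i) (Sum.inr j) ≤ E.ρ * (1 + E.δ) * E.U
  radius_le : ∀ j : C, σ.L (s.level j) ≤ σ.τ * E.R j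
  sparse_radius : ∀ t : ℝ, 0 < t → ∀ p ∈ s.facilities.disjSum (Finset.univ : Finset C),
    (Finset.card {j ∈ I.toGKM.clientBall p (E.δ * t / (4 + 3 * E.δ)) | t ≤ E.R j} : ℝ)
      ≤ E.ρ * (1 + 3 * E.δ / 4) / (1 - E.δ / 4) * (E.U / t)

end

/-! ## Radii and discretized distances -/

/-! Apart from the first, the Extra Invariants are upper bounds that survive when the program
shrinks. Facilities, balls and levels never grow. Hence the sums of distances over $\{j : i\in
F_j\}$ lose nonnegative terms and $L(\ell_j)$ does not increase; invariant 4 is either independent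
of the program or quantified over fewer points.

The first invariant needs an argument: a client of $C^*$ of level $-1$ must stay in $C^*$, and its
ball may lose deleted facilities only. It is never shrunk, because only clients of $C_{full}$ are,
and $C_{full}$ is disjoint from $C^*$. ReRoute evicts only from level $\ell_j+2\ge 1$ on, and a
candidate configuration moves a client of level at least $\ell_{j'}+1\ge 0$. All this rests on
levels staying at least $-1$, which holds because a client of level $-1$ has $B_j=\emptyset$, so
$y(B_j)=1$ fails.

`Refines` records this shrinking and is transitive. `Separated` is what each step needs and
preserves: the bound on levels, and the disjointness of the three client sets.
`Separated.pseudoApproximationRun` carries both along a run. -/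

theorem RadiusScale.L_nonneg (σ : RadiusScale) {l : ℤ} (hl : -1 ≤ l) : 0 ≤ σ.L l := by
  have hα := σ.one_le_α
  have hτ := σ.one_lt_τ
  unfold RadiusScale.L
  split_ifs with h₀ h₁
  · positivity
  · exact le_rfl
  · omega

/-- The radii are monotone on the levels `ℓ ≥ -1`. -/
theorem RadiusScale.L_mono (σ : RadiusScale) {l l' : ℤ} (hl : -1 ≤ l) (h : l ≤ l') :
    σ.L l ≤ σ.L l' := by
  rcases hl.eq_or_lt with rfl | hl
  · simpa [RadiusScale.L] using σ.L_nonneg h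
  · have h₀ : 0 ≤ l := by omega
    have hα := σ.one_le_α
    simp only [RadiusScale.L, if_pos h₀, if_pos (h₀.trans h)]
    exact mul_le_mul_of_nonneg_left (zpow_le_zpow_right₀ σ.one_lt_τ.le h) (by linarith)

theorem GKMInstance.d'_nonneg {F C : Type*} {r₁ r₂ : ℕ} (I : GKMInstance F C r₁ r₂)
    (σ : RadiusScale) (p q : F ⊕ C) : 0 ≤ I.d' σ p q := by
  refine Real.sInf_nonneg ?_
  rintro x ⟨l, hl, rfl, -⟩
  exact σ.L_nonneg hl

theorem GKMInstance.d_nonneg {F C : Type*} {r₁ r₂ : ℕ} (I : GKMInstance F C r₁ r₂)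
    (p q : F ⊕ C) : 0 ≤ I.d p q :=
  letI := I.metric
  dist_nonneg

namespace LPIter

variable {F C : Type*} {r₁ r₂ : ℕ}

/-- The inner ball of a client of level `-1` is empty, since `L(-2) < 0`. -/
theorem inner_eq_empty_of_level_eq (s : LPIter F C) (I : GKMInstance F C r₁ r₂)
    (σ : RadiusScale) {j : C} (hj : s.level j = -1) : s.inner I σ j = ∅ := by
  refine Finset.filter_eq_empty_iff.2 fun i _ => ?_
  have h := I.d'_nonneg σ (Sum.inr j) (Sum.inl i)
  have hL : σ.L (s.level j - 1) = -1 := by simp [RadiusScale.L, hj]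
  rw [hL]
  linarith

/-! ## Invariants of a single modification -/

/-- The part of the Basic Invariants on which the Extra Invariants depend. -/
structure Separated (s : LPIter F C) : Prop where
  part_full : Disjoint s.part s.full
  part_star : Disjoint s.part s.star
  full_star : Disjoint s.full s.star
  level_ge : ∀ j, -1 ≤ s.level j

/-- `s'` arises from `s` by shrinking the set of facilities, the balls and the levels, in such a
way that the clients of `C^*` of level `-1` stay there and lose deleted facilities only. -/
structure Refines (s s' : LPIter F C) : Prop where
  facilities_subset : s'.facilities ⊆ s.facilities
  ball_subset : ∀ j, s'.ball j ⊆ s.ball j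
  level_le : ∀ j, s'.level j ≤ s.level j
  star : ∀ j ∈ s.star, s.level j = -1 → j ∈ s'.star ∧ s'.level j = -1 ∧
    ∀ i, i ∈ s'.ball j ↔ i ∈ s.ball j ∧ i ∈ s'.facilities

theorem Refines.trans {s₁ s₂ s₃ : LPIter F C} (h : Refines s₁ s₂) (h' : Refines s₂ s₃) :
    Refines s₁ s₃ where
  facilities_subset := h'.facilities_subset.trans h.facilities_subset
  ball_subset j := (h'.ball_subset j).trans (h.ball_subset j)
  level_le j := (h'.level_le j).trans (h.level_le j)
  star j hj hl := by
    obtain ⟨hj₂, hl₂, hb₂⟩ := h.star j hj hl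
    obtain ⟨hj₃, hl₃, hb₃⟩ := h'.star j hj₂ hl₂
    refine ⟨hj₃, hl₃, fun i => ?_⟩
    rw [hb₃, hb₂]
    exact ⟨fun hi => ⟨hi.1.1, hi.2⟩, fun hi => ⟨⟨hi.1, h'.facilities_subset hi.2⟩, hi.2⟩⟩

/-- A modification that changes neither the facilities nor the balls and levels refines, if it
keeps the clients of `C^*` of level `-1`. -/
theorem Refines.of_eq {s s' : LPIter F C} (hf : s'.facilities = s.facilities)
    (hb : s'.ball = s.ball) (hl : s'.level = s.level)
    (hs : ∀ j ∈ s.star, s.level j = -1 → j ∈ s'.star) : Refines s s' where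
  facilities_subset := hf.subset
  ball_subset j := by rw [hb]
  level_le j := by rw [hl]
  star j hj hj' := ⟨hs j hj hj', by rw [hl, hj'], fun i => by
    rw [hb, hf]
    exact ⟨fun hi => ⟨hi, s.ball_subset j hi⟩, And.left⟩⟩

theorem Refines.refl (s : LPIter F C) : Refines s s :=
  .of_eq rfl rfl rfl fun _ hj _ => hj

/-- The same client remains a witness. In the application `P` is collocation with a fixed guessed
facility, which does not depend on the program. -/
theorem Refines.guessed {s s' : LPIter F C} (h : Refines s s') {P : F → Prop}
    (hP : ∃ j ∈ s.star, (∀ i, i ∈ s.ball j ↔ i ∈ s.facilities ∧ P i) ∧ s.level j = -1) :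
    ∃ j ∈ s'.star, (∀ i, i ∈ s'.ball j ↔ i ∈ s'.facilities ∧ P i) ∧ s'.level j = -1 := by
  obtain ⟨j, hj, hb, hl⟩ := hP
  obtain ⟨hj', hl', hb'⟩ := h.star j hj hl
  refine ⟨j, hj', fun i => ?_, hl'⟩
  have := @h.facilities_subset i
  rw [hb', hb]
  tauto

/-- Balls only shrink, so fewer clients have `i` in their ball, and the dropped distances are
nonnegative. -/
theorem Refines.sum_dist_le [Fintype C] [DecidableEq F] {s s' : LPIter F C}
    (h : Refines s s') (I : GKMInstance F C r₁ r₂) (i : F) :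
    ∑ j : C with i ∈ s'.ball j, I.d (Sum.inl i) (Sum.inr j)
      ≤ ∑ j : C with i ∈ s.ball j, I.d (Sum.inl i) (Sum.inr j) :=
  Finset.sum_le_sum_of_subset_of_nonneg
    (Finset.monotone_filter_right _ fun j _ hj => h.ball_subset j hj)
    fun _ _ _ => I.d_nonneg _ _

theorem Refines.radius_le {s s' : LPIter F C} (h : Refines s s') (h' : s'.Separated)
    (σ : RadiusScale) (j : C) : σ.L (s'.level j) ≤ σ.L (s.level j) :=
  σ.L_mono (h'.level_ge j) (h.level_le j)

theorem BasicInvariants.separated [Fintype C] [DecidableEq F] [DecidableEq C] {s : LPIter F C}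
    {I : GKMInstance F C r₁ r₂} {σ : RadiusScale} (h : s.BasicInvariants I σ) : s.Separated :=
  ⟨h.disjoint_part_full, h.disjoint_part_star, h.disjoint_full_star, h.level_ge⟩

theorem Separated.deleteFacility [DecidableEq F] {s : LPIter F C} (h : s.Separated) (i : F) :
    (s.deleteFacility i).Separated :=
  ⟨h.part_full, h.part_star, h.full_star, h.level_ge⟩

theorem refines_deleteFacility [DecidableEq F] (s : LPIter F C) (i : F) :
    Refines s (s.deleteFacility i) where
  facilities_subset := Finset.erase_subset _ _
  ball_subset _ := Finset.erase_subset _ _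
  level_le _ := le_rfl
  star j hj hl := by
    refine ⟨hj, hl, fun i' => ?_⟩
    have := @s.ball_subset j i'
    simp only [LPIter.deleteFacility, Finset.mem_erase]
    tauto

variable [DecidableEq C]

theorem Separated.movePartToFull {s : LPIter F C} (h : s.Separated) {j : C} (hj : j ∈ s.part) :
    (s.movePartToFull j).Separated where
  part_full := by
    have := h.part_full
    rw [Finset.disjoint_left] at this ⊢
    simp only [LPIter.movePartToFull, Finset.mem_erase, Finset.mem_insert]
    intro a ha
    have := @this a
    tauto
  part_star := h.part_star.mono_left (Finset.erase_subset _ _)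
  full_star := Finset.disjoint_insert_left.2
    ⟨Finset.disjoint_left.1 h.part_star hj, h.full_star⟩
  level_ge := h.level_ge

theorem refines_movePartToFull (s : LPIter F C) (j : C) : Refines s (s.movePartToFull j) :=
  .of_eq rfl rfl rfl fun _ hj' _ => hj'

theorem Separated.moveStarToFull {s : LPIter F C} (h : s.Separated) {j : C} (hj : j ∈ s.star) :
    (s.moveStarToFull j).Separated where
  part_full := Finset.disjoint_insert_right.2
    ⟨Finset.disjoint_right.1 h.part_star hj, h.part_full⟩
  part_star := h.part_star.mono_right (Finset.erase_subset _ _)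
  full_star := by
    have := h.full_star
    rw [Finset.disjoint_left] at this ⊢
    simp only [LPIter.moveStarToFull, Finset.mem_erase, Finset.mem_insert]
    intro a ha
    have := @this a
    tauto
  level_ge := h.level_ge

theorem refines_moveStarToFull (s : LPIter F C) {j : C} (hj : s.level j ≠ -1) :
    Refines s (s.moveStarToFull j) :=
  .of_eq rfl rfl rfl fun _ hj' hl =>
    Finset.mem_erase.2 ⟨by rintro rfl; exact hj hl, hj'⟩

theorem Separated.reRoute [DecidableEq F] {s : LPIter F C} (h : s.Separated) {j : C}
    (hj : j ∈ s.full) : (s.reRoute j).Separated := by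
  unfold LPIter.reRoute
  split_ifs
  · have hpf := h.part_full
    have hps := h.part_star
    have hfs := h.full_star
    rw [Finset.disjoint_left] at hpf hps hfs
    refine ⟨?_, ?_, ?_, h.level_ge⟩ <;> rw [Finset.disjoint_left] <;> intro a <;>
      simp only [Finset.mem_union, Finset.mem_erase, Finset.mem_filter, Finset.mem_insert,
        Finset.mem_sdiff, LPIter.neighbors]
    · have := @hpf a
      have := @hps a
      tauto
    · have := @hps a
      have := @hpf a
      intro ha
      rintro (rfl | ha')
      · exact hpf ha hj
      · exact hps ha ha'.1
    · have := @hfs a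
      rintro (ha | ha) (rfl | ha')
      · exact ha.1 rfl
      · exact hfs ha.2 ha'.1
      -- `j` does not evict itself: evicted clients come from `s.star`, while `j` lies in `s.full`.
      · exact hfs hj ha.1.1
      · exact ha'.2 ha
  · exact h

/-- Evicted clients have level at least $\ell_j+2\ge 1$, so none of level $-1$ leaves $C^*$. -/
theorem Separated.refines_reRoute [DecidableEq F] {s : LPIter F C} (h : s.Separated) (j : C) :
    Refines s (s.reRoute j) := by
  unfold LPIter.reRoute
  split_ifs
  · refine .of_eq rfl rfl rfl fun j' hj' hl => ?_
    have := h.level_ge j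
    refine Finset.mem_insert_of_mem (Finset.mem_sdiff.2 ⟨hj', fun hmem => ?_⟩)
    have := (Finset.mem_filter.1 hmem).2
    omega
  · exact .refl s

theorem Separated.shrink {s : LPIter F C} (h : s.Separated) (I : GKMInstance F C r₁ r₂)
    (σ : RadiusScale) {j : C} (hj : s.level j ≠ -1) : (s.shrink I σ j).Separated where
  part_full := h.part_full
  part_star := h.part_star
  full_star := h.full_star
  level_ge j' := by
    have := h.level_ge j
    have := h.level_ge j'
    simp only [LPIter.shrink]
    split_ifs <;> omega

/-- A client of $C_{full}$ is not in $C^*$, so the balls and levels of $C^*$ are untouched. -/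
theorem Separated.refines_shrink {s : LPIter F C} (h : s.Separated) (I : GKMInstance F C r₁ r₂)
    (σ : RadiusScale) {j : C} (hj : j ∈ s.full) : Refines s (s.shrink I σ j) where
  facilities_subset := Finset.Subset.refl _
  ball_subset j' := by
    simp only [LPIter.shrink]
    split_ifs with hjj'
    · subst hjj'
      exact Finset.filter_subset _ _
    · exact Finset.Subset.refl _
  level_le j' := by
    simp only [LPIter.shrink]
    split_ifs with hjj'
    · subst hjj'
      omega
    · exact le_rfl
  star j' hj' hl := by
    have hne : j' ≠ j := by
      rintro rfl
      exact Finset.disjoint_left.1 h.full_star hj hj'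
    refine ⟨hj', ?_, fun i => ?_⟩
    · simpa only [LPIter.shrink, if_neg hne] using hl
    · simp only [LPIter.shrink, if_neg hne]
      exact ⟨fun hi => ⟨hi, s.ball_subset j' hi⟩, And.left⟩

/-! ## Iterations of the algorithm -/

theorem Separated.iterativeRoundStep [DecidableEq F] {I : GKMInstance F C r₁ r₂}
    {σ : RadiusScale} {s s' : LPIter F C} {y : F → ℝ} (h : s.Separated)
    (hs : IterativeRoundStep I σ s y s') : s'.Separated ∧ Refines s s' := by
  cases hs with
  | delete i _ _ => exact ⟨h.deleteFacility i, refines_deleteFacility s i⟩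
  | connect j hj _ =>
    have h' := h.movePartToFull hj
    exact ⟨h'.reRoute (Finset.mem_insert_self _ _),
      (refines_movePartToFull s j).trans (h'.refines_reRoute j)⟩
  | shrink j hj hy =>
    -- At level $-1$ the inner ball would be empty and `hy` would read $0=1$. Thus the decremented
    -- level is still at least $-1$.
    have hl : s.level j ≠ -1 := by
      intro hl
      simp [s.inner_eq_empty_of_level_eq I σ hl] at hy
    have h' := h.shrink I σ hl
    exact ⟨h'.reRoute hj, (h.refines_shrink I σ hj).trans (h'.refines_reRoute j)⟩

theorem Separated.pseudoApproximationStep [Fintype F] [DecidableEq F]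
    {I : GKMInstance F C r₁ r₂} {σ : RadiusScale} {s s' : LPIter F C} (h : s.Separated)
    (hs : PseudoApproximationStep I σ s s') : s'.Separated ∧ Refines s s' := by
  cases hs with
  | round y _ _ hs => exact h.iterativeRoundStep hs
  | configReRoute y _ _ j j' hj =>
    refine ⟨h.moveStarToFull hj.left_mem, refines_moveStarToFull s ?_⟩
    -- The partner `j'` lies strictly below `j` and has level at least $-1$, so `j` has level at
    -- least $0$.
    have := h.level_ge j'
    have := hj.level_le
    omega

theorem Separated.pseudoApproximationRun [Fintype F] [DecidableEq F]
    {I : GKMInstance F C r₁ r₂} {σ : RadiusScale} {s s' : LPIter F C} (h : s.Separated)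
    (hs : PseudoApproximationRun I σ s s') : s'.Separated ∧ Refines s s' := by
  induction hs with
  | refl => exact ⟨h, .refl s⟩
  | tail _ hstep ih =>
    have h' := ih.1.pseudoApproximationStep hstep
    exact ⟨h'.1, ih.2.trans h'.2⟩

end LPIter

/-! ### Transfer of the Extra Invariants along a refinement -/

theorem KnapsackExtraInvariants.of_refines {F C : Type*} [Fintype C] [DecidableEq F]
    {I : KnapsackMedian F C} {σ : RadiusScale} {E : ExtraData F C} {s s' : LPIter F C}
    (hE : KnapsackExtraInvariants I σ E s) (h : LPIter.Refines s s') (h' : s'.Separated) :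
    KnapsackExtraInvariants I σ E s' where
  guessed i hi := h.guessed (hE.guessed i hi)
  sparse_facility i hi hi' := (h.sum_dist_le I.toGKM i).trans
    (hE.sparse_facility i (h.facilities_subset hi) hi')
  radius_le j := (h.radius_le h' σ j).trans (hE.radius_le j)
  sparse_radius := hE.sparse_radius

theorem OutlierExtraInvariants.of_refines {F C : Type*} [Fintype C] [DecidableEq F]
    {I : OutlierMedian F C} {σ : RadiusScale} {E : ExtraData F C} {s s' : LPIter F C}
    (hE : OutlierExtraInvariants I σ E s) (h : LPIter.Refines s s') (h' : s'.Separated) :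
    OutlierExtraInvariants I σ E s' where
  guessed i hi := h.guessed (hE.guessed i hi)
  sparse_facility i hi hi' := (h.sum_dist_le I.toGKM i).trans
    (hE.sparse_facility i (h.facilities_subset hi) hi')
  radius_le j := (h.radius_le h' σ j).trans (hE.radius_le j)
  -- Here `p` ranges over the current facilities and all clients, a set that only shrinks.
  sparse_radius t ht p hp := hE.sparse_radius t ht p
    (Finset.disjSum_mono h.facilities_subset (Finset.Subset.refl _) hp)

theorem mainTheorem9 {F C : Type*} [Fintype F] [Fintype C] [DecidableEq F] [DecidableEq C]
    (σ : RadiusScale) (E : ExtraData F C) :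
    (∀ (I : KnapsackMedian F C) (s s' : LPIter F C),
      s.BasicInvariants I.toGKM σ →
      KnapsackExtraInvariants I σ E s →
      LPIter.PseudoApproximationRun I.toGKM σ s s' →
      KnapsackExtraInvariants I σ E s') ∧
    (∀ (I : OutlierMedian F C) (s s' : LPIter F C),
      s.BasicInvariants I.toGKM σ →
      OutlierExtraInvariants I σ E s →
      LPIter.PseudoApproximationRun I.toGKM σ s s' →
      OutlierExtraInvariants I σ E s') := by
  constructor
  · intro I s s' hB hE hrun
    obtain ⟨h', h⟩ := hB.separated.pseudoApproximationRun hrun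
    exact hE.of_refines h h'
  · intro I s s' hB hE hrun
    obtain ⟨h', h⟩ := hB.separated.pseudoApproximationRun hrun
    exact hE.of_refines h h'
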